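/- Let $\mathcal H$ be a separable complex Hilbert space (of finite or infinite dimension), let $\|T\|_1=\mathrm{Tr}\,(T^\dagger T)^{1/2}$ be the trace norm, and let $E(\mathcal H)$ be the set of density operators on $\mathcal H$, i.e. of the nonnegative trace class operators $Q$ with $\mathrm{Tr}\,Q=1$, with the metric $(Q,Q')\mapsto\|Q-Q'\|_1$. For $Q\in E(\mathcal H)$ with eigenvalues $\lambda_1,\lambda_2,\dots$, repeated according to multiplicity, put $$\det(\mathrm I+Q)^{\pm(\mathrm I+Q)}=\prod_k(1+\lambda_k)^{\pm(1+\lambda_k)},\qquad \mathrm{FEN}_\pm(Q)=\log\det(\mathrm I+Q)^{\pm(\mathrm I+Q)} .$$ Then for every $Q\in E(\mathcal H)$ both products converge unconditionally to positive real numbers, and both $$\mathrm{FEN}_\pm(Q)=\pm\sum_k(1+\lambda_k)\log(1+\lambda_k)$$ are finite, the series being unconditionally convergent. Moreover, both functions $\mathrm{FEN}_+$ and $\mathrm{FEN}_-$ are continuous on $E(\mathcal H)$ with respect to the trace norm. -/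

import Mathlib

open scoped ENNReal InnerProductSpace

namespace RenormalizedEntropy

noncomputable section

section TraceClass

variable {H : Type*} [NormedAddCommGroup H] [InnerProductSpace ℂ H] [CompleteSpace H]

/-- The index set of a fixed orthonormal (Hilbert) basis of `H`. -/
def onbIndex (H : Type*) [NormedAddCommGroup H] [InnerProductSpace ℂ H] [CompleteSpace H] :
    Set H :=
  (exists_hilbertBasis ℂ H).choose

/-- A fixed orthonormal (Hilbert) basis of `H`. It is only used to write down traces; the trace of
a nonnegative operator and the trace of a trace class operator do not depend on it. -/
def onb (H : Type*) [NormedAddCommGroup H] [InnerProductSpace ℂ H] [CompleteSpace H] :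
    HilbertBasis (onbIndex H) ℂ H :=
  (exists_hilbertBasis ℂ H).choose_spec.choose

/-- The trace norm `‖T‖₁ = Tr |T|`, with `|T| = (T† T)^(1/2)`, as an element of `[0, ∞]`. -/
def traceNorm (T : H →L[ℂ] H) : ℝ≥0∞ :=
  ∑' i, ENNReal.ofReal (⟪onb H i, CFC.abs T (onb H i)⟫_ℂ).re

/-- `T` is of trace class: `‖T‖₁ < ∞`. -/
def IsTraceClass (T : H →L[ℂ] H) : Prop := traceNorm T < ∞

/-- The trace `Tr T = ∑ᵢ ⟨eᵢ, T eᵢ⟩` of a trace class operator. -/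
def trace (T : H →L[ℂ] H) : ℂ :=
  ∑' i, ⟪onb H i, T (onb H i)⟫_ℂ

/-- The space `E(H)` of quantum states (density operators): nonnegative trace class operators of
trace one. -/
def stateSpace (H : Type*) [NormedAddCommGroup H] [InnerProductSpace ℂ H] [CompleteSpace H] :
    Set (H →L[ℂ] H) :=
  {Q | Q.IsPositive ∧ IsTraceClass Q ∧ trace Q = 1}

/-- Continuity of a real function on a set `S` of operators, for the distance
`(Q, Q') ↦ ‖Q' - Q‖₁`. -/
def TraceNormContinuousOn (F : (H →L[ℂ] H) → ℝ) (S : Set (H →L[ℂ] H)) : Prop :=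
  ∀ Q ∈ S, ∀ ε : ℝ, 0 < ε → ∃ δ : ℝ, 0 < δ ∧
    ∀ Q' ∈ S, traceNorm (Q' - Q) < ENNReal.ofReal δ → |F Q' - F Q| < ε

end TraceClass

section Entropy

variable {H : Type*} [NormedAddCommGroup H] [InnerProductSpace ℂ H]

/-- An index type for the real eigenvalues of `Q` counted with multiplicity: for each real `μ` there
are as many indices as the dimension of the eigenspace of `μ` (none if `μ` is not an eigenvalue). -/
def EigenIndex (Q : H →L[ℂ] H) : Type _ :=
  Σ μ : ℝ, (Module.rank ℂ (Module.End.eigenspace (Q : H →ₗ[ℂ] H) (μ : ℂ))).out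

/-- The family `(λ_k)` of eigenvalues of `Q`, repeated according to multiplicity. -/
def eigenvalue (Q : H →L[ℂ] H) (k : EigenIndex Q) : ℝ := k.1

/-- `det (I + Q)^(I + Q) = ∏ₖ (1 + λₖ)^(1 + λₖ)`. -/
def detPlus (Q : H →L[ℂ] H) : ℝ :=
  ∏' k : EigenIndex Q, (1 + eigenvalue Q k) ^ (1 + eigenvalue Q k)

/-- `det (I + Q)^(-(I + Q)) = ∏ₖ (1 + λₖ)^(-(1 + λₖ))`. -/
def detMinus (Q : H →L[ℂ] H) : ℝ :=
  ∏' k : EigenIndex Q, (1 + eigenvalue Q k) ^ (-(1 + eigenvalue Q k))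

/-- The renormalized entropy `FEN₊(Q) = log det (I + Q)^(I + Q)`. -/
def fenPlus (Q : H →L[ℂ] H) : ℝ := Real.log (detPlus Q)

/-- The renormalized entropy `FEN₋(Q) = log det (I + Q)^(-(I + Q))`. -/
def fenMinus (Q : H →L[ℂ] H) : ℝ := Real.log (detMinus Q)

end Entropy

end

end RenormalizedEntropy

open RenormalizedEntropy

/-!
# Renormalized entropies are finite and Lipschitz for the trace norm

Put `f x = (1 + x) log (1 + x)`. The eigenvalues of a state are summable with sum at most `1`, and
`0 ≤ f x ≤ 2 x` on `[0, 1]`, so `∑ f(λₖ)` converges absolutely; exponentiating gives both products,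
and `FEN₋ = -FEN₊`.

Continuity comes from the explicit bound `|FEN₊(B) - FEN₊(A)| ≤ 2 ‖B - A‖₁`
(`abs_fenPlus_sub_le`), which follows from convexity of `f`. Let `A eₖ = λₖ eₖ` and `B bⱼ = μⱼ bⱼ`
with Hilbert bases `e` and `b`. The tangent of `f` at `λₖ` lies below `f`; averaging it at the
points `μⱼ` with the weights `|⟪bⱼ, eₖ⟫|²` gives (`entropyFun_le_tsum_add`)
`f(λₖ) ≤ ∑ⱼ |⟪bⱼ, eₖ⟫|² f(μⱼ) + 2 |⟪eₖ, (B - A) eₖ⟫|`,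
because the weights have total mass `1` and mean `⟪eₖ, B eₖ⟫`, and the slope of `f` is in `[0, 2]`
on `[0, 1]`. Summing over `k`, the first term gives `∑ⱼ f(μⱼ)` by Parseval, and the second is at
most `2 ‖B - A‖₁` because `|⟪x, T x⟫| ≤ ⟪x, |T| x⟫` for self-adjoint `T`
(`tsum_abs_re_inner_le_traceNorm`).

Eigenbases exist by the spectral theorem for compact self-adjoint operators, once a positive
operator of finite trace is known to be compact (`isCompactOperator_of_tsum_ne_top`). Sums over such
a basis are compared with sums over `EigenIndex` in `exists_hilbertBasis_eigenvector`.
-/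

namespace RenormalizedEntropy

/-! ### Parseval and Bessel in `[0, ∞]` -/

section Bessel

variable {H : Type*} [NormedAddCommGroup H] [InnerProductSpace ℂ H]

theorem hasSum_norm_inner_sq {ι : Type*} (b : HilbertBasis ι ℂ H) (x : H) :
    HasSum (fun i => ‖⟪b i, x⟫_ℂ‖ ^ 2) (‖x‖ ^ 2) := by
  have h := Complex.hasSum_re (b.hasSum_inner_mul_inner x x)
  convert! h using 1
  · funext i
    rw [← inner_conj_symm x (b i), Complex.conj_mul', ← Complex.ofReal_pow, Complex.ofReal_re]
  · exact (inner_self_eq_norm_sq (𝕜 := ℂ) x).symm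

theorem tsum_ofReal_norm_inner_sq {ι : Type*} (b : HilbertBasis ι ℂ H) (x : H) :
    ∑' i, ENNReal.ofReal (‖⟪b i, x⟫_ℂ‖ ^ 2) = ENNReal.ofReal (‖x‖ ^ 2) := by
  have h := hasSum_norm_inner_sq b x
  rw [← h.tsum_eq, ENNReal.ofReal_tsum_of_nonneg (fun _ => by positivity) h.summable]

theorem tsum_ofReal_norm_inner_sq_le {κ : Type*} {e : κ → H} (he : Orthonormal ℂ e) (x : H) :
    ∑' k, ENNReal.ofReal (‖⟪e k, x⟫_ℂ‖ ^ 2) ≤ ENNReal.ofReal (‖x‖ ^ 2) := by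
  rw [← ENNReal.ofReal_tsum_of_nonneg (fun _ => by positivity) (he.inner_products_summable x)]
  exact ENNReal.ofReal_le_ofReal (he.tsum_inner_products_le x)

end Bessel

/-! ### Traces of positive operators along orthonormal families -/

section Trace

variable {H : Type*} [NormedAddCommGroup H] [InnerProductSpace ℂ H] [CompleteSpace H]

theorem isPositive_sqrt (A : H →L[ℂ] H) : (CFC.sqrt A).IsPositive :=
  (ContinuousLinearMap.nonneg_iff_isPositive _).1 (CFC.sqrt_nonneg A)

theorem sqrt_apply_sqrt_apply {A : H →L[ℂ] H} (hA : A.IsPositive) (x : H) :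
    CFC.sqrt A (CFC.sqrt A x) = A x := by
  rw [← mul_apply_eq_comp,
    CFC.sqrt_mul_sqrt_self A ((ContinuousLinearMap.nonneg_iff_isPositive A).2 hA)]

theorem inner_sqrt_apply (A : H →L[ℂ] H) (x y : H) :
    ⟪CFC.sqrt A x, y⟫_ℂ = ⟪x, CFC.sqrt A y⟫_ℂ :=
  (isPositive_sqrt A).isSymmetric x y

theorem re_inner_apply_eq_norm_sqrt_sq {A : H →L[ℂ] H} (hA : A.IsPositive) (x : H) :
    (⟪x, A x⟫_ℂ).re = ‖CFC.sqrt A x‖ ^ 2 := by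
  rw [← sqrt_apply_sqrt_apply hA, ← inner_sqrt_apply]
  exact inner_self_eq_norm_sq (𝕜 := ℂ) _

/-- The partial trace of a positive operator along an orthonormal family is at most its trace. With
`S = A ^ (1/2)` both sides are sums of `|⟪S bᵢ, eₖ⟫|²`, and Bessel's inequality applies to `e`. -/
theorem tsum_orthonormal_le_tsum_hilbertBasis {A : H →L[ℂ] H} (hA : A.IsPositive)
    {κ ι : Type*} {e : κ → H} (he : Orthonormal ℂ e) (b : HilbertBasis ι ℂ H) :
    ∑' k, ENNReal.ofReal (⟪e k, A (e k)⟫_ℂ).re ≤ ∑' i, ENNReal.ofReal (⟪b i, A (b i)⟫_ℂ).re := by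
  simp_rw [re_inner_apply_eq_norm_sqrt_sq hA]
  calc ∑' k, ENNReal.ofReal (‖CFC.sqrt A (e k)‖ ^ 2)
      = ∑' k, ∑' i, ENNReal.ofReal (‖⟪e k, CFC.sqrt A (b i)⟫_ℂ‖ ^ 2) := by
        refine tsum_congr fun k => ?_
        rw [← tsum_ofReal_norm_inner_sq b]
        refine tsum_congr fun i => ?_
        rw [← inner_sqrt_apply, norm_inner_symm]
    _ = ∑' i, ∑' k, ENNReal.ofReal (‖⟪e k, CFC.sqrt A (b i)⟫_ℂ‖ ^ 2) := ENNReal.tsum_comm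
    _ ≤ _ := ENNReal.tsum_le_tsum fun i => tsum_ofReal_norm_inner_sq_le he _

theorem abs_re_inner_le_re_inner_abs {T : H →L[ℂ] H} (hT : IsSelfAdjoint T) (x : H) :
    |(⟪x, T x⟫_ℂ).re| ≤ (⟪x, CFC.abs T x⟫_ℂ).re := by
  have h1 : (CFC.abs T - T).IsPositive := by
    rw [← ContinuousLinearMap.nonneg_iff_isPositive, CFC.abs_sub_self T hT, two_smul]
    exact add_nonneg (CFC.negPart_nonneg T) (CFC.negPart_nonneg T)
  have h2 : (CFC.abs T + T).IsPositive := by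
    rw [← ContinuousLinearMap.nonneg_iff_isPositive, CFC.abs_add_self T hT, two_smul]
    exact add_nonneg (CFC.posPart_nonneg T) (CFC.posPart_nonneg T)
  have h1' : 0 ≤ (⟪x, (CFC.abs T - T) x⟫_ℂ).re := h1.re_inner_nonneg_right x
  have h2' : 0 ≤ (⟪x, (CFC.abs T + T) x⟫_ℂ).re := h2.re_inner_nonneg_right x
  simp only [sub_apply, add_apply, inner_sub_right,
    inner_add_right, Complex.sub_re, Complex.add_re] at h1' h2'
  exact abs_le.2 ⟨by linarith, by linarith⟩

theorem tsum_abs_re_inner_le_traceNorm {T : H →L[ℂ] H} (hT : IsSelfAdjoint T)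
    {κ : Type*} {e : κ → H} (he : Orthonormal ℂ e) :
    ∑' k, ENNReal.ofReal |(⟪e k, T (e k)⟫_ℂ).re| ≤ traceNorm T := by
  refine (ENNReal.tsum_le_tsum fun k => ENNReal.ofReal_le_ofReal
    (abs_re_inner_le_re_inner_abs hT (e k))).trans ?_
  exact tsum_orthonormal_le_tsum_hilbertBasis
    ((ContinuousLinearMap.nonneg_iff_isPositive _).1 (CFC.abs_nonneg T)) he (onb H)

/-- Positive operators of finite trace are compact: `A ^ (1/2)` is Hilbert-Schmidt, hence the norm
limit of its finite rank truncations `∑ i ∈ s, |bᵢ⟩⟨A ^ (1/2) bᵢ|`. -/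
theorem isCompactOperator_of_tsum_ne_top {A : H →L[ℂ] H} (hA : A.IsPositive)
    {ι : Type*} (b : HilbertBasis ι ℂ H)
    (h : ∑' i, ENNReal.ofReal (⟪b i, A (b i)⟫_ℂ).re ≠ ∞) : IsCompactOperator A := by
  classical
  suffices hS : IsCompactOperator (CFC.sqrt A : H →L[ℂ] H) by
    have := hS.clm_comp (CFC.sqrt A)
    convert! this using 1
    funext x
    exact (sqrt_apply_sqrt_apply hA x).symm
  simp_rw [re_inner_apply_eq_norm_sqrt_sq hA] at h
  have hcl : IsClosed {f : H →L[ℂ] H | IsCompactOperator f} :=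
    isClosed_setOfPred_isCompactOperator
  refine hcl.closure_subset (Metric.mem_closure_iff.2 fun ε hε => ?_)
  obtain ⟨s, hs⟩ := ((ENNReal.tendsto_tsum_compl_atTop_zero h).eventually
    (gt_mem_nhds (show (0 : ℝ≥0∞) < ENNReal.ofReal ((ε / 2) ^ 2) by positivity))).exists
  refine ⟨∑ i ∈ s, InnerProductSpace.rankOne ℂ (b i) (CFC.sqrt A (b i)), ?_, ?_⟩
  · refine sum_mem (S := compactOperator (RingHom.id ℂ) H H) fun i _ => ?_
    exact (isCompactOperator_of_locallyCompactSpace_dom (innerSL ℂ (CFC.sqrt A (b i)))).clm_comp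
      (ContinuousLinearMap.toSpanSingleton ℂ (b i))
  · rw [dist_eq_norm]
    refine (ContinuousLinearMap.opNorm_le_bound _ (half_pos hε).le fun x => ?_).trans_lt
      (half_lt_self hε)
    set y := (CFC.sqrt A - ∑ i ∈ s, InnerProductSpace.rankOne ℂ (b i) (CFC.sqrt A (b i))) x with hy
    have hin (j : ι) : ⟪b j, y⟫_ℂ = if j ∈ s then 0 else ⟪CFC.sqrt A (b j), x⟫_ℂ := by
      simp [hy, orthonormal_iff_ite.1 b.orthonormal, inner_sqrt_apply]
      split_ifs <;> simp
    have hle : ENNReal.ofReal (‖y‖ ^ 2) ≤ ENNReal.ofReal ((ε / 2 * ‖x‖) ^ 2) := by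
      rw [← tsum_ofReal_norm_inner_sq b, mul_pow, ENNReal.ofReal_mul (by positivity)]
      calc ∑' i, ENNReal.ofReal (‖⟪b i, y⟫_ℂ‖ ^ 2)
          = ∑' i : {i // i ∉ s}, ENNReal.ofReal (‖⟪b i, y⟫_ℂ‖ ^ 2) := by
            refine (tsum_subtype_eq_of_support_subset (s := {i | i ∉ s}) fun i hi his => hi ?_).symm
            simp [hin, his]
        _ ≤ ∑' i : {i // i ∉ s},
            ENNReal.ofReal (‖CFC.sqrt A (b i)‖ ^ 2) * ENNReal.ofReal (‖x‖ ^ 2) := by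
            refine ENNReal.tsum_le_tsum fun i => ?_
            rw [hin, if_neg i.2, ← ENNReal.ofReal_mul (by positivity), ← mul_pow]
            gcongr
            exact norm_inner_le_norm _ _
        _ ≤ _ := by
            rw [ENNReal.tsum_mul_right]
            gcongr
    rw [ENNReal.ofReal_le_ofReal_iff (by positivity)] at hle
    exact le_of_sq_le_sq hle (by positivity)

end Trace

/-! ### Eigenbases of compact self-adjoint operators -/

section Compact

universe u

variable {H : Type u} [NormedAddCommGroup H] [InnerProductSpace ℂ H] [CompleteSpace H]

open Module.End

/-- The spectral theorem in terms of `EigenIndex`: a compact self-adjoint operator has a Hilbert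
basis of eigenvectors, and its eigenvalues agree with the family `eigenvalue Q`, up to reindexing,
after the zero eigenvalue is removed. (For the eigenvalue zero, `EigenIndex` is a Hamel basis of the
kernel, which need not have the cardinality of a Hilbert basis when the kernel is infinite
dimensional.) -/
theorem exists_hilbertBasis_eigenvector {Q : H →L[ℂ] H} (hQ : IsCompactOperator Q)
    (hs : (Q : H →ₗ[ℂ] H).IsSymmetric) :
    ∃ (ι : Type u) (b : HilbertBasis ι ℂ H) (μ : ι → ℝ), (∀ i, Q (b i) = (μ i : ℂ) • b i) ∧
      ∀ (g : ℝ → ℝ) (a : ℝ), g 0 = 0 →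
        (HasSum (fun k => g (eigenvalue Q k)) a ↔ HasSum (fun i => g (μ i)) a) := by
  let E (μ : ℝ) : Submodule ℂ H := eigenspace (Q : H →ₗ[ℂ] H) (μ : ℂ)
  have hEc (μ : ℝ) : CompleteSpace (E μ) := by
    have : IsClosed (E μ : Set H) := by
      have : (E μ : Set H) = {x | Q x = (μ : ℂ) • x} := by
        ext x; exact mem_eigenspace_iff
      rw [this]
      exact isClosed_eq Q.continuous (continuous_const_smul _)
    exact this.completeSpace_coe
  choose w v _ using fun μ : ℝ => exists_hilbertBasis ℂ (E μ)
  have horth : OrthogonalFamily ℂ (fun μ : ℝ => E μ) fun μ => (E μ).subtypeₗᵢ :=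
    hs.orthogonalFamily_eigenspaces.comp Complex.ofReal_injective
  have hon := horth.orthonormal_sigma_orthonormal (fun μ => (v μ).orthonormal)
  have hspan : (Submodule.span ℂ (Set.range fun a : Σ μ : ℝ, w μ =>
      (E a.1).subtypeₗᵢ (v a.1 a.2)))ᗮ = ⊥ := by
    rw [eq_bot_iff, ← ContinuousLinearMap.orthogonalComplement_iSup_eigenspaces_eq_bot hQ hs,
      ← Submodule.iInf_orthogonal]
    intro x hx
    rw [Submodule.mem_iInf]
    intro z
    -- Eigenspaces of non-real numbers are trivial, so the real ones suffice.
    by_cases hz : HasEigenvalue (Q : H →ₗ[ℂ] H) z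
    swap
    · rw [hasEigenvalue_iff, not_not] at hz
      simp [hz]
    obtain ⟨μ, rfl⟩ := Complex.conj_eq_iff_real.1 (hs.conj_eigenvalue_eq_self hz)
    rw [Submodule.mem_orthogonal']
    intro y hy
    have h := ((v μ).hasSum_repr ⟨y, hy⟩).mapL (innerSL ℂ x ∘L (E μ).subtypeL)
    have h0 (i : w μ) : ⟪x, (v μ i : H)⟫_ℂ = 0 :=
      (Submodule.mem_orthogonal' _ _).1 hx _ (Submodule.subset_span ⟨⟨μ, i⟩, rfl⟩)
    have h' : HasSum (fun _ : w μ => (0 : ℂ)) ⟪x, y⟫_ℂ := by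
      simpa [inner_smul_right, h0] using h
    exact h'.unique hasSum_zero
  have hcard (μ : ℝ) (hμ : μ ≠ 0) : Nonempty ((Module.rank ℂ (E μ)).out ≃ w μ) := by
    have : FiniteDimensional ℂ (E μ) :=
      ContinuousLinearMap.finite_dimensional_eigenspace hQ _ (Complex.ofReal_ne_zero.2 hμ)
    have : Finite (w μ) := (v μ).orthonormal.linearIndependent.finite
    have := Fintype.ofFinite (w μ)
    rw [← Cardinal.eq, Cardinal.mk_out, (v μ).toOrthonormalBasis.toBasis.mk_eq_rank'']
  have φ (μ : ℝ) (hμ : μ ≠ 0) := (hcard μ hμ).some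
  refine ⟨Σ μ : ℝ, w μ, HilbertBasis.mkOfOrthogonalEqBot hon hspan, fun i => i.1, ?_, ?_⟩
  · rintro ⟨μ, i⟩
    rw [HilbertBasis.coe_mkOfOrthogonalEqBot]
    exact mem_eigenspace_iff.1 (v μ i).2
  · intro g a hg
    -- `J` enumerates the nonzero eigenvalues, and embeds into both index types.
    let J := Σ μ : {μ : ℝ // μ ≠ 0}, (Module.rank ℂ (E μ)).out
    let p : J → EigenIndex Q := fun k => ⟨k.1, k.2⟩
    let q : J → Σ μ : ℝ, w μ := fun k => ⟨k.1, φ k.1 k.1.2 k.2⟩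
    have hp : p.Injective := by
      rintro ⟨⟨μ, hμ⟩, i⟩ ⟨⟨ν, hν⟩, j⟩ h
      obtain ⟨rfl, h⟩ := Sigma.mk.inj_iff.1 h
      exact congrArg (Sigma.mk _) (eq_of_heq h)
    have hq : q.Injective := by
      rintro ⟨⟨μ, hμ⟩, i⟩ ⟨⟨ν, hν⟩, j⟩ h
      obtain ⟨rfl, h⟩ := Sigma.mk.inj_iff.1 h
      exact congrArg (Sigma.mk _) ((φ μ hμ).injective (eq_of_heq h))
    rw [← hp.hasSum_iff, ← hq.hasSum_iff]
    · rfl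
    · rintro ⟨μ, i⟩ hi
      by_cases hμ : μ = 0
      · simp [hμ, hg]
      · exact absurd ⟨⟨⟨μ, hμ⟩, (φ μ hμ).symm i⟩, by simp [q]⟩ hi
    · rintro ⟨μ, i⟩ hi
      by_cases hμ : μ = 0
      · simp [eigenvalue, hμ, hg]
      · exact absurd ⟨⟨⟨μ, hμ⟩, i⟩, rfl⟩ hi

end Compact

/-! ### The function `(1 + x) log (1 + x)` -/

section RealFunction

/-- The function `x ↦ (1 + x) log (1 + x)` whose sum over the spectrum is `FEN₊`. -/
noncomputable def entropyFun (x : ℝ) : ℝ := (1 + x) * Real.log (1 + x)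

theorem entropyFun_zero : entropyFun 0 = 0 := by simp [entropyFun]

theorem entropyFun_nonneg {x : ℝ} (hx : 0 ≤ x) : 0 ≤ entropyFun x :=
  mul_nonneg (by linarith) (Real.log_nonneg (by linarith))

theorem entropyFun_le {x : ℝ} (h0 : 0 ≤ x) (h1 : x ≤ 1) : entropyFun x ≤ 2 * x := by
  have h := Real.log_le_sub_one_of_pos (show 0 < 1 + x by linarith)
  unfold entropyFun
  nlinarith [Real.log_nonneg (show 1 ≤ 1 + x by linarith)]

/-- The convex function `entropyFun` lies above its tangent at `x`, of slope `1 + log (1 + x)`. -/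
theorem tangent_le_entropyFun {x y : ℝ} (hx : 0 ≤ x) (hy : 0 ≤ y) :
    (1 + y) * Real.log (1 + x) + y - x ≤ entropyFun y := by
  have hx' : 0 < 1 + x := by linarith
  have hy' : 0 < 1 + y := by linarith
  have h := Real.log_le_sub_one_of_pos (div_pos hx' hy')
  rw [Real.log_div hx'.ne' hy'.ne'] at h
  have h2 := mul_le_mul_of_nonneg_left h hy'.le
  have h3 : (1 + y) * ((1 + x) / (1 + y) - 1) = x - y := by field_simp; ring
  unfold entropyFun
  linarith

end RealFunction

/-! ### A Peierls-type convexity inequality -/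

section Peierls

variable {H : Type*} [NormedAddCommGroup H] [InnerProductSpace ℂ H]

/-- A Peierls-type inequality: `entropyFun x`, up to an error controlled by the distance of `x` to
the quadratic form of `B` at `v`, is at most `⟪v, entropyFun(B) v⟫`, the latter written in an
eigenbasis `b` of `B`. The tangent of `entropyFun` at `x` is averaged against the probability
weights `|⟪b j, v⟫|²`, under which the eigenvalues of `B` have mean `⟪v, B v⟫`. -/
theorem entropyFun_le_tsum_add {B : H →L[ℂ] H} (hB : B.IsPositive) {ι : Type*}
    (b : HilbertBasis ι ℂ H) {μ : ι → ℝ} (hb : ∀ i, B (b i) = (μ i : ℂ) • b i) (h0 : ∀ i, 0 ≤ μ i)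
    (h1 : ∀ i, μ i ≤ 1) {v : H} (hv : ‖v‖ = 1) {x : ℝ} (hx0 : 0 ≤ x) (hx1 : x ≤ 1) :
    Summable (fun j => ‖⟪b j, v⟫_ℂ‖ ^ 2 * entropyFun (μ j)) ∧
      entropyFun x ≤ ∑' j, ‖⟪b j, v⟫_ℂ‖ ^ 2 * entropyFun (μ j) + 2 * |(⟪v, B v⟫_ℂ).re - x| := by
  have hw : HasSum (fun j => ‖⟪b j, v⟫_ℂ‖ ^ 2) 1 := by
    simpa [hv] using hasSum_norm_inner_sq b v
  have hm : HasSum (fun j => ‖⟪b j, v⟫_ℂ‖ ^ 2 * μ j) (⟪v, B v⟫_ℂ).re := by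
    convert! Complex.hasSum_re (b.hasSum_inner_mul_inner v (B v)) using 2 with j
    have h : ⟪b j, B v⟫_ℂ = μ j * ⟪b j, v⟫_ℂ := by
      have h' : ⟪B (b j), v⟫_ℂ = ⟪b j, B v⟫_ℂ := hB.isSymmetric (b j) v
      rw [← h', hb, inner_smul_left, Complex.conj_ofReal]
    rw [h, ← inner_conj_symm v (b j), mul_left_comm, Complex.conj_mul', ← Complex.ofReal_pow,
      ← Complex.ofReal_mul, Complex.ofReal_re, mul_comm]
  have hf : Summable fun j => ‖⟪b j, v⟫_ℂ‖ ^ 2 * entropyFun (μ j) := by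
    refine (hw.summable.mul_left 2).of_nonneg_of_le
      (fun j => mul_nonneg (by positivity) (entropyFun_nonneg (h0 j))) fun j => ?_
    rw [mul_comm]
    gcongr
    linarith [entropyFun_le (h0 j) (h1 j), h1 j]
  refine ⟨hf, ?_⟩
  -- The tangent `y ↦ (1 + y) log (1 + x) + y - x`, split into its constant and linear parts.
  have ht := (hw.mul_left (Real.log (1 + x) - x)).add (hm.mul_left (1 + Real.log (1 + x)))
  have hle := hasSum_le (fun j => ?_) ht hf.hasSum
  · have hl0 : 0 ≤ Real.log (1 + x) := Real.log_nonneg (by linarith)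
    have hl1 := Real.log_le_sub_one_of_pos (show 0 < 1 + x by linarith)
    have habs := neg_abs_le ((⟪v, B v⟫_ℂ).re - x)
    have : -(2 * |(⟪v, B v⟫_ℂ).re - x|) ≤ (1 + Real.log (1 + x)) * ((⟪v, B v⟫_ℂ).re - x) := by
      nlinarith [abs_nonneg ((⟪v, B v⟫_ℂ).re - x)]
    unfold entropyFun at *
    linarith
  · have := mul_le_mul_of_nonneg_left (tangent_le_entropyFun hx0 (h0 j))
      (show 0 ≤ ‖⟪b j, v⟫_ℂ‖ ^ 2 by positivity)
    linarith

end Peierls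

/-! ### States, their spectra and their entropies -/

section Eigenvalue

variable {H : Type*} [NormedAddCommGroup H] [InnerProductSpace ℂ H]

/-- Holds for every index since `EigenIndex` only ranges over nonzero eigenspaces. -/
theorem eigenvalue_nonneg {Q : H →L[ℂ] H} (hQ : Q.IsPositive) (k : EigenIndex Q) :
    0 ≤ eigenvalue Q k := by
  obtain ⟨μ, i⟩ := k
  refine eigenvalue_nonneg_of_nonneg (T := (Q : H →ₗ[ℂ] H)) ?_
    fun x => hQ.re_inner_nonneg_right x
  rw [Module.End.hasEigenvalue_iff]
  intro h
  change Module.End.eigenspace (Q : H →ₗ[ℂ] H) (μ : ℂ) = ⊥ at h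
  have : Module.rank ℂ (Module.End.eigenspace (Q : H →ₗ[ℂ] H) (μ : ℂ)) = 0 := by
    rw [h]; exact rank_bot ℂ H
  have hi := Cardinal.mk_ne_zero_iff.2 ⟨i⟩
  rw [Cardinal.mk_out] at hi
  exact hi this

theorem log_rpow_one_add_eigenvalue {Q : H →L[ℂ] H} (hQ : Q.IsPositive) (k : EigenIndex Q) :
    Real.log ((1 + eigenvalue Q k) ^ (1 + eigenvalue Q k)) = entropyFun (eigenvalue Q k) :=
  Real.log_rpow (by linarith [eigenvalue_nonneg hQ k]) _

theorem log_rpow_neg_one_add_eigenvalue {Q : H →L[ℂ] H} (hQ : Q.IsPositive) (k : EigenIndex Q) :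
    Real.log ((1 + eigenvalue Q k) ^ (-(1 + eigenvalue Q k))) = -entropyFun (eigenvalue Q k) := by
  rw [Real.log_rpow (by linarith [eigenvalue_nonneg hQ k]), neg_mul, entropyFun]

end Eigenvalue

section State

universe u

variable {H : Type u} [NormedAddCommGroup H] [InnerProductSpace ℂ H] [CompleteSpace H]

/-- Absolute convergence is part of the claim: the sum is taken in `[0, ∞]`, whereas the series in
`trace` would be zero by convention if it diverged. -/
theorem tsum_onb_eq_one {Q : H →L[ℂ] H} (hQ : Q ∈ stateSpace H) :
    ∑' i, ENNReal.ofReal (⟪onb H i, Q (onb H i)⟫_ℂ).re = 1 := by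
  obtain ⟨hpos, htc, htr⟩ := hQ
  have hnn (i) : 0 ≤ (⟪onb H i, Q (onb H i)⟫_ℂ).re := hpos.re_inner_nonneg_right _
  have hne : ∑' i, ENNReal.ofReal (⟪onb H i, Q (onb H i)⟫_ℂ).re ≠ ∞ := by
    have h := htc.ne
    rwa [traceNorm, CFC.abs_of_nonneg Q ((ContinuousLinearMap.nonneg_iff_isPositive Q).2 hpos)] at h
  have hsum : Summable fun i => (⟪onb H i, Q (onb H i)⟫_ℂ).re := by
    convert! ENNReal.summable_toReal hne using 2 with i
    rw [ENNReal.toReal_ofReal (hnn i)]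
  have hre (i) : ⟪onb H i, Q (onb H i)⟫_ℂ = ((⟪onb H i, Q (onb H i)⟫_ℂ).re : ℂ) := by
    have := hpos.isSymmetric.coe_re_inner_self_apply (onb H i)
    exact this.symm
  rw [← ENNReal.ofReal_tsum_of_nonneg hnn hsum]
  rw [trace, tsum_congr hre, ← Complex.ofReal_tsum] at htr
  rw [Complex.ofReal_eq_one.1 htr, ENNReal.ofReal_one]

/-- A state has a Hilbert basis of eigenvectors; its eigenvalues lie in `[0, 1]`, are summable, and
represent the family `eigenvalue Q` up to reindexing and up to the zero eigenvalues. -/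
theorem exists_spectral_decomposition {Q : H →L[ℂ] H} (hQ : Q ∈ stateSpace H) :
    ∃ (ι : Type u) (b : HilbertBasis ι ℂ H) (μ : ι → ℝ), (∀ i, Q (b i) = (μ i : ℂ) • b i) ∧
      (∀ i, 0 ≤ μ i) ∧ (∀ i, μ i ≤ 1) ∧ Summable μ ∧
      ∀ (g : ℝ → ℝ) (a : ℝ), g 0 = 0 →
        (HasSum (fun k => g (eigenvalue Q k)) a ↔ HasSum (fun i => g (μ i)) a) := by
  have hpos := hQ.1
  have h1 := tsum_onb_eq_one hQ
  obtain ⟨ι, b, μ, hμ, hg⟩ := exists_hilbertBasis_eigenvector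
    (isCompactOperator_of_tsum_ne_top hpos (onb H) (h1 ▸ ENNReal.one_ne_top)) hpos.isSymmetric
  have hin (i : ι) : (⟪b i, Q (b i)⟫_ℂ).re = μ i := by
    rw [hμ, inner_smul_right, inner_self_eq_norm_sq_to_K, b.orthonormal.1 i]
    simp
  have h0 (i : ι) : 0 ≤ μ i := hin i ▸ hpos.re_inner_nonneg_right (b i)
  have hle : ∑' i, ENNReal.ofReal (μ i) ≤ 1 := by
    simp_rw [← hin, ← h1]
    exact tsum_orthonormal_le_tsum_hilbertBasis hpos b.orthonormal (onb H)
  refine ⟨ι, b, μ, hμ, h0, fun i => ?_, ?_, hg⟩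
  · exact ENNReal.ofReal_le_one.1 ((ENNReal.le_tsum i).trans hle)
  · convert! ENNReal.summable_toReal (hle.trans_lt ENNReal.one_lt_top).ne using 2 with i
    rw [ENNReal.toReal_ofReal (h0 i)]

theorem summable_entropyFun_eigenvalue {Q : H →L[ℂ] H} (hQ : Q ∈ stateSpace H) :
    Summable fun k => entropyFun (eigenvalue Q k) := by
  obtain ⟨ι, b, μ, -, h0, h1, hs, hg⟩ := exists_spectral_decomposition hQ
  have : Summable fun i => entropyFun (μ i) :=
    (hs.mul_left 2).of_nonneg_of_le (fun i => entropyFun_nonneg (h0 i))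
      fun i => entropyFun_le (h0 i) (h1 i)
  exact ⟨_, (hg entropyFun _ entropyFun_zero).2 this.hasSum⟩

theorem multipliable_detPlus {Q : H →L[ℂ] H} (hQ : Q ∈ stateSpace H) :
    Multipliable fun k : EigenIndex Q => (1 + eigenvalue Q k) ^ (1 + eigenvalue Q k) :=
  Real.multipliable_of_summable_log
    (fun k => Real.rpow_pos_of_pos (by linarith [eigenvalue_nonneg hQ.1 k]) _)
    (by simpa only [log_rpow_one_add_eigenvalue hQ.1] using summable_entropyFun_eigenvalue hQ)

theorem multipliable_detMinus {Q : H →L[ℂ] H} (hQ : Q ∈ stateSpace H) :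
    Multipliable fun k : EigenIndex Q => (1 + eigenvalue Q k) ^ (-(1 + eigenvalue Q k)) :=
  Real.multipliable_of_summable_log
    (fun k => Real.rpow_pos_of_pos (by linarith [eigenvalue_nonneg hQ.1 k]) _)
    (by simpa only [log_rpow_neg_one_add_eigenvalue hQ.1] using
      (summable_entropyFun_eigenvalue hQ).neg)

theorem detPlus_eq_exp {Q : H →L[ℂ] H} (hQ : Q ∈ stateSpace H) :
    detPlus Q = Real.exp (∑' k, entropyFun (eigenvalue Q k)) := by
  simp_rw [← log_rpow_one_add_eigenvalue hQ.1]
  refine (Real.rexp_tsum_eq_tprod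
    (fun k => Real.rpow_pos_of_pos (by linarith [eigenvalue_nonneg hQ.1 k]) _) ?_).symm
  simpa only [log_rpow_one_add_eigenvalue hQ.1] using summable_entropyFun_eigenvalue hQ

theorem detMinus_eq_exp {Q : H →L[ℂ] H} (hQ : Q ∈ stateSpace H) :
    detMinus Q = Real.exp (∑' k, -entropyFun (eigenvalue Q k)) := by
  simp_rw [← log_rpow_neg_one_add_eigenvalue hQ.1]
  refine (Real.rexp_tsum_eq_tprod
    (fun k => Real.rpow_pos_of_pos (by linarith [eigenvalue_nonneg hQ.1 k]) _) ?_).symm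
  simpa only [log_rpow_neg_one_add_eigenvalue hQ.1] using (summable_entropyFun_eigenvalue hQ).neg

theorem hasSum_fenPlus {Q : H →L[ℂ] H} (hQ : Q ∈ stateSpace H) :
    HasSum (fun k => entropyFun (eigenvalue Q k)) (fenPlus Q) := by
  rw [fenPlus, detPlus_eq_exp hQ, Real.log_exp]
  exact (summable_entropyFun_eigenvalue hQ).hasSum

theorem hasSum_fenMinus {Q : H →L[ℂ] H} (hQ : Q ∈ stateSpace H) :
    HasSum (fun k => -entropyFun (eigenvalue Q k)) (fenMinus Q) := by
  rw [fenMinus, detMinus_eq_exp hQ, Real.log_exp]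
  exact (summable_entropyFun_eigenvalue hQ).neg.hasSum

theorem fenMinus_eq_neg_fenPlus {Q : H →L[ℂ] H} (hQ : Q ∈ stateSpace H) :
    fenMinus Q = -fenPlus Q :=
  (hasSum_fenMinus hQ).unique (hasSum_fenPlus hQ).neg

theorem traceNorm_neg (T : H →L[ℂ] H) : traceNorm (-T) = traceNorm T := by
  rw [traceNorm, CFC.abs_neg, traceNorm]

/-- One half of the Lipschitz estimate for `FEN₊`: the Peierls-type inequality summed over an
eigenbasis `e` of `A`. The weights `|⟪bⱼ, eₖ⟫|²` are doubly stochastic, so summing over `k` turns the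
first term into the trace of `entropyFun(B)`. -/
theorem ofReal_fenPlus_le {A B : H →L[ℂ] H} (hA : A ∈ stateSpace H) (hB : B ∈ stateSpace H) :
    ENNReal.ofReal (fenPlus A) ≤ ENNReal.ofReal (fenPlus B) + 2 * traceNorm (B - A) := by
  obtain ⟨κ, e, l, he, hl0, hl1, -, hgA⟩ := exists_spectral_decomposition hA
  obtain ⟨ι, b, μ, hb, hμ0, hμ1, -, hgB⟩ := exists_spectral_decomposition hB
  have hFA := (hgA entropyFun _ entropyFun_zero).1 (hasSum_fenPlus hA)
  have hFB := (hgB entropyFun _ entropyFun_zero).1 (hasSum_fenPlus hB)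
  have hT : IsSelfAdjoint (B - A) := hB.1.isSelfAdjoint.sub hA.1.isSelfAdjoint
  rw [← hFA.tsum_eq, ← hFB.tsum_eq,
    ENNReal.ofReal_tsum_of_nonneg (fun k => entropyFun_nonneg (hl0 k)) hFA.summable,
    ENNReal.ofReal_tsum_of_nonneg (fun k => entropyFun_nonneg (hμ0 k)) hFB.summable]
  have hk (k : κ) : ENNReal.ofReal (entropyFun (l k)) ≤
      ∑' j, ENNReal.ofReal (‖⟪e k, b j⟫_ℂ‖ ^ 2) * ENNReal.ofReal (entropyFun (μ j)) +
        2 * ENNReal.ofReal |(⟪e k, (B - A) (e k)⟫_ℂ).re| := by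
    have hre : (⟪e k, (B - A) (e k)⟫_ℂ).re = (⟪e k, B (e k)⟫_ℂ).re - l k := by
      rw [sub_apply, inner_sub_right, he, inner_smul_right, inner_self_eq_norm_sq_to_K,
        e.orthonormal.1 k]
      simp
    obtain ⟨hs, hle⟩ := entropyFun_le_tsum_add hB.1 b hb hμ0 hμ1 (e.orthonormal.1 k) (hl0 k) (hl1 k)
    refine (ENNReal.ofReal_le_ofReal hle).trans ?_
    refine ENNReal.ofReal_add_le.trans (add_le_add ?_ ?_)
    · rw [ENNReal.ofReal_tsum_of_nonneg
        (fun j => mul_nonneg (by positivity) (entropyFun_nonneg (hμ0 j))) hs]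
      refine (tsum_congr fun j => ?_).le
      rw [ENNReal.ofReal_mul (by positivity), norm_inner_symm]
    · rw [hre, ENNReal.ofReal_mul zero_le_two, ENNReal.ofReal_ofNat]
  refine (ENNReal.tsum_le_tsum hk).trans ?_
  rw [ENNReal.tsum_add, ENNReal.tsum_mul_left, ENNReal.tsum_comm]
  gcongr with j
  · rw [ENNReal.tsum_mul_right, tsum_ofReal_norm_inner_sq e, b.orthonormal.1]
    simp
  · exact tsum_abs_re_inner_le_traceNorm hT e.orthonormal

/-- `FEN₊` is Lipschitz on the state space, with constant 2, for the trace norm. -/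
theorem abs_fenPlus_sub_le {A B : H →L[ℂ] H} (hA : A ∈ stateSpace H) (hB : B ∈ stateSpace H)
    (h : traceNorm (B - A) ≠ ∞) :
    |fenPlus B - fenPlus A| ≤ 2 * (traceNorm (B - A)).toReal := by
  have key {A B : H →L[ℂ] H} (hA : A ∈ stateSpace H) (hB : B ∈ stateSpace H)
      (h : traceNorm (B - A) ≠ ∞) : fenPlus A ≤ fenPlus B + 2 * (traceNorm (B - A)).toReal := by
    have hB0 : 0 ≤ fenPlus B :=
      (hasSum_fenPlus hB).nonneg fun k => entropyFun_nonneg (eigenvalue_nonneg hB.1 k)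
    have := ofReal_fenPlus_le hA hB
    rw [← ENNReal.ofReal_toReal h, ← ENNReal.ofReal_ofNat 2, ← ENNReal.ofReal_mul zero_le_two,
      ← ENNReal.ofReal_add hB0 (by positivity), ENNReal.ofReal_le_ofReal_iff (by positivity)] at this
    exact this
  have hsymm : traceNorm (A - B) = traceNorm (B - A) := by rw [← traceNorm_neg, neg_sub]
  have h1 := key hA hB h
  have h2 := key hB hA (hsymm ▸ h)
  rw [hsymm] at h2
  exact abs_sub_le_iff.2 ⟨by linarith, by linarith⟩

theorem traceNormContinuousOn_fenPlus : TraceNormContinuousOn fenPlus (stateSpace H) := by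
  intro Q hQ ε hε
  refine ⟨ε / 2, half_pos hε, fun Q' hQ' h => ?_⟩
  have hlt := ENNReal.toReal_lt_of_lt_ofReal h
  linarith [abs_fenPlus_sub_le hQ hQ' h.ne_top]

theorem traceNormContinuousOn_fenMinus : TraceNormContinuousOn fenMinus (stateSpace H) := by
  intro Q hQ ε hε
  obtain ⟨δ, hδ, h⟩ := traceNormContinuousOn_fenPlus Q hQ ε hε
  refine ⟨δ, hδ, fun Q' hQ' hd => ?_⟩
  rw [fenMinus_eq_neg_fenPlus hQ, fenMinus_eq_neg_fenPlus hQ', neg_sub_neg, abs_sub_comm]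
  exact h Q' hQ' hd

end State

end RenormalizedEntropy

theorem theorem2 (H : Type*) [NormedAddCommGroup H] [InnerProductSpace ℂ H] [CompleteSpace H]
    [TopologicalSpace.SeparableSpace H] :
    (∀ Q ∈ stateSpace H,
      -- the two infinite products converge to a nonzero limit
      (Multipliable (fun k : EigenIndex Q => (1 + eigenvalue Q k) ^ (1 + eigenvalue Q k)) ∧
        0 < detPlus Q) ∧
      (Multipliable (fun k : EigenIndex Q => (1 + eigenvalue Q k) ^ (-(1 + eigenvalue Q k))) ∧
        0 < detMinus Q) ∧
      -- both entropies are the sums of convergent series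
      HasSum (fun k : EigenIndex Q => (1 + eigenvalue Q k) * Real.log (1 + eigenvalue Q k))
        (fenPlus Q) ∧
      HasSum (fun k : EigenIndex Q => -((1 + eigenvalue Q k) * Real.log (1 + eigenvalue Q k)))
        (fenMinus Q)) ∧
    TraceNormContinuousOn fenPlus (stateSpace H) ∧
    TraceNormContinuousOn fenMinus (stateSpace H) :=
  ⟨fun _ hQ => ⟨⟨multipliable_detPlus hQ, detPlus_eq_exp hQ ▸ Real.exp_pos _⟩,
    ⟨multipliable_detMinus hQ, detMinus_eq_exp hQ ▸ Real.exp_pos _⟩,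
    hasSum_fenPlus hQ, hasSum_fenMinus hQ⟩,
    traceNormContinuousOn_fenPlus, traceNormContinuousOn_fenMinus⟩
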